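/- Theorem (Convergence of the augmented Lagrangian method for BD-RCS). Let $\widehat{\mathcal A}:\mathbb R^{K\times N}\to\mathbb C^L$ be a real-linear operator, $\widehat{\mathbf y}\in\mathbb C^L$, $\lambda>0$, and consider the convex problem $$\min_{X\in\mathbb R^{K\times N}}\ \|X\|_*+\lambda\|X\|_{2,1}\quad\text{s.t.}\quad \widehat{\mathbf y}=\widehat{\mathcal A}(X),\qquad(\ast)$$ where $\|X\|_*$ is the nuclear norm (sum of the singular values) and $\|X\|_{2,1}=\sum_{i=1}^K\|e_i^TX\|_2$ is the sum of the Euclidean norms of the rows. For $r\ge 0$, $Z\in\mathbb R^{K\times r}$, $H\in\mathbb R^{N\times r}$, $w\in\mathbb R^K_{>0}$, $\alpha\in\mathbb C^L$, $\sigma>0$ let $$\mathcal L_{\sigma}(Z,H,w;\alpha)=\|Z\|_F^2+\|H\|_F^2-2\,\mathrm{Re}\,\alpha^H\big(\widehat{\mathcal A}(ZH^T)-\widehat{\mathbf y}\big)+\sigma\|\widehat{\mathcal A}(ZH^T)-\widehat{\mathbf y}\|_2^2+\sum_{i=1}^K\Big(w_i+\lambda^2\frac{\|e_i^TZH^T\|_2^2}{w_i}\Big).$$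 Let $\sigma_0,\varepsilon_0>0$, $\rho>1$, and let sequences be generated as follows from an arbitrary $(Z^0,H^0)$: $w^0_i=\lambda\|e_i^TZ^0H^{0T}\|_2+\varepsilon_0$, $\alpha^0=0$, and for $k=0,1,2,\dots$ 1. $(Z^{k+1},H^{k+1})$ is a local minimum of $(Z,H)\mapsto\mathcal L_{\sigma_k}(Z,H,w^k;\alpha^k)$ (the inner L-BFGS step is assumed to succeed in this sense); 2. $w^{k+1}_i=\lambda\|e_i^TZ^{k+1}H^{(k+1)T}\|_2+\varepsilon_0/(k+2)^2$; 3. $\alpha^{k+1}=\alpha^k-\sigma_k\big(\widehat{\mathcal A}(Z^{k+1}H^{(k+1)T})-\widehat{\mathbf y}\big)$; 4. $\sigma_{k+1}=\rho\,\sigma_k$. Assume that for some $\delta>0$ one has $\|\widehat{\mathcal A}(X)\|_2^2\ge\delta\|X\|_F^2$ for all $X\in\mathbb R^{K\times N}$ with $\mathrm{rank}(X)\le 2r$. Let $X^*$ be a minimizer of $(\ast)$ with $\mathrm{rank}(X^*)\le r$ (so that $X^*=Z^*H^{*T}$ for some $Z^*\in\mathbb R^{K\times r}$, $H^*\in\mathbb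 R^{N\times r}$), and assume that $r$ is sufficiently large in the following sense: either $r\ge\min(K,N)$ (so that every $X\in\mathbb R^{K\times N}$ has a factorization $X=ZH^T$), or $r>\mathrm{rank}(Z^{k+1}H^{(k+1)T})$ for all $k\ge0$. Then $$\lim_{k\to\infty}Z^kH^{kT}=X^*.$$ -/

import Mathlib

open Matrix Filter Topology

noncomputable section

namespace BDRCS

variable {K N r L : ℕ}

/-- The squared Frobenius norm of a real matrix. -/
def frobSq {m n : ℕ} (X : Matrix (Fin m) (Fin n) ℝ) : ℝ :=
  ∑ i, ∑ j, X i j ^ 2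

/-- The Euclidean norm of the `i`-th row of `X`. -/
def rowNorm (X : Matrix (Fin K) (Fin N) ℝ) (i : Fin K) : ℝ :=
  √(∑ j, X i j ^ 2)

/-- The norm `‖X‖_{2,1}`, the sum of the Euclidean norms of the rows. -/
def norm21 (X : Matrix (Fin K) (Fin N) ℝ) : ℝ :=
  ∑ i, rowNorm X i

/-- The nuclear norm, the sum of the singular values
(the operator `ℝ^N → ℝ^K` has `N` of them, counted with zeros). -/
def nuclearNorm (X : Matrix (Fin K) (Fin N) ℝ) : ℝ :=
  ∑ i ∈ Finset.range N, (Matrix.toEuclideanLin X).singularValues i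

/-- `X` solves: minimize `‖X‖_* + lam ‖X‖_{2,1}` subject to `y = A X`. -/
def IsMinimizer (A : Matrix (Fin K) (Fin N) ℝ →ₗ[ℝ] EuclideanSpace ℂ (Fin L))
    (y : EuclideanSpace ℂ (Fin L)) (lam : ℝ) (X : Matrix (Fin K) (Fin N) ℝ) : Prop :=
  A X = y ∧ ∀ X' : Matrix (Fin K) (Fin N) ℝ, A X' = y →
    nuclearNorm X + lam * norm21 X ≤ nuclearNorm X' + lam * norm21 X'

/-- The restricted lower bound `‖A X‖² ≥ δ ‖X‖_F²` on matrices of rank at most `s`. -/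
def RestrictedLowerBound (A : Matrix (Fin K) (Fin N) ℝ →ₗ[ℝ] EuclideanSpace ℂ (Fin L))
    (δ : ℝ) (s : ℕ) : Prop :=
  ∀ X : Matrix (Fin K) (Fin N) ℝ, X.rank ≤ s → δ * frobSq X ≤ ‖A X‖ ^ 2

/-- The augmented Lagrangian
`‖Z‖_F² + ‖H‖_F² - 2 Re(αᴴ (A(Z Hᵀ) - y)) + σ ‖A(Z Hᵀ) - y‖²
  + ∑ i, (w_i + lam² ‖e_iᵀ Z Hᵀ‖² / w_i)`. -/
def augLagrangian (A : Matrix (Fin K) (Fin N) ℝ →ₗ[ℝ] EuclideanSpace ℂ (Fin L))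
    (y : EuclideanSpace ℂ (Fin L)) (lam σ : ℝ)
    (Z : Matrix (Fin K) (Fin r) ℝ) (H : Matrix (Fin N) (Fin r) ℝ)
    (w : Fin K → ℝ) (α : EuclideanSpace ℂ (Fin L)) : ℝ :=
  frobSq Z + frobSq H - 2 * (inner ℂ α (A (Z * Hᵀ) - y)).re
    + σ * ‖A (Z * Hᵀ) - y‖ ^ 2
    + ∑ i, (w i + lam ^ 2 * (rowNorm (Z * Hᵀ) i ^ 2 / w i))

/-- The inner minimization step: `(Z', H')` is a local minimum of the augmented Lagrangian
in `(Z, H)`, the weights `w`, the multiplier `α` and the penalty `σ` being fixed. -/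
def IsInnerLocalMin (A : Matrix (Fin K) (Fin N) ℝ →ₗ[ℝ] EuclideanSpace ℂ (Fin L))
    (y : EuclideanSpace ℂ (Fin L)) (lam σ : ℝ) (w : Fin K → ℝ) (α : EuclideanSpace ℂ (Fin L))
    (Z' : Matrix (Fin K) (Fin r) ℝ) (H' : Matrix (Fin N) (Fin r) ℝ) : Prop :=
  IsLocalMin (fun p : Matrix (Fin K) (Fin r) ℝ × Matrix (Fin N) (Fin r) ℝ =>
    augLagrangian A y lam σ p.1 p.2 w α) (Z', H')

/-- The sequences produced by the augmented Lagrangian algorithm (run without a stopping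
iteration) from an arbitrary starting point `(Z 0, H 0)`: in iteration `k` the inner solver returns
a local minimum `(Z (k+1), H (k+1))`, and then the weights, the multiplier and the penalty
are updated. -/
structure IsRun (A : Matrix (Fin K) (Fin N) ℝ →ₗ[ℝ] EuclideanSpace ℂ (Fin L))
    (y : EuclideanSpace ℂ (Fin L)) (lam ρ σ₀ ε₀ : ℝ)
    (Z : ℕ → Matrix (Fin K) (Fin r) ℝ) (H : ℕ → Matrix (Fin N) (Fin r) ℝ)
    (w : ℕ → Fin K → ℝ) (α : ℕ → EuclideanSpace ℂ (Fin L)) (σ : ℕ → ℝ) : Prop where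
  w_zero : ∀ i, w 0 i = lam * rowNorm (Z 0 * (H 0)ᵀ) i + ε₀
  α_zero : α 0 = 0
  σ_zero : σ 0 = σ₀
  inner_step : ∀ k, IsInnerLocalMin A y lam (σ k) (w k) (α k) (Z (k + 1)) (H (k + 1))
  w_succ : ∀ k i, w (k + 1) i =
    lam * rowNorm (Z (k + 1) * (H (k + 1))ᵀ) i + ε₀ / ((k : ℝ) + 2) ^ 2
  α_succ : ∀ k, α (k + 1) = α k - σ k • (A (Z (k + 1) * (H (k + 1))ᵀ) - y)
  σ_succ : ∀ k, σ (k + 1) = ρ * σ k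

end BDRCS

end

namespace BDRCS

/-! Put `X_k = Z_k H_kᵀ`. Both `X_k` and `Xstar` have rank at most `r`, so the restricted lower
bound controls `X_k - Xstar` by the residual `A X_k - y`, and it suffices that the residual tends to
zero.

The multiplier update gives `σ_k (A X_{k+1} - y) = α_k - α_{k+1}`, which reduces the claim to `‖α_k‖
/ σ_k → 0`. At a local minimum the half gradient `G`, formed with the updated multiplier `α_{k+1}`,
has entries of modulus at most one (`abs_halfGradient_le_one`). Since the weights are at least `ε₀ /
(k+1)²`, this bounds `α_{k+1}` by a quadratic polynomial in `k` times one plus the residual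
(`exists_multiplier_bound`). The geometric growth of `σ_k` beats that factor, and the resulting
recursion forces the limit (`tendsto_zero_of_recursion`). -/

/-- The Frobenius inner product of two real matrices. -/
def frobInner {m n : ℕ} (X Y : Matrix (Fin m) (Fin n) ℝ) : ℝ :=
  ∑ i, ∑ j, X i j * Y i j

section frob

variable {m n s : ℕ}

lemma sq_apply_le_frobSq (X : Matrix (Fin m) (Fin n) ℝ) (i : Fin m) (j : Fin n) :
    X i j ^ 2 ≤ frobSq X :=
  (Finset.single_le_sum (f := fun j => X i j ^ 2) (fun _ _ => sq_nonneg _)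
    (Finset.mem_univ j)).trans
    (Finset.single_le_sum (f := fun i => ∑ j, X i j ^ 2)
      (fun _ _ => Finset.sum_nonneg fun _ _ => sq_nonneg _) (Finset.mem_univ i))

lemma eq_zero_of_frobSq_nonpos {X : Matrix (Fin m) (Fin n) ℝ} (h : frobSq X ≤ 0) : X = 0 := by
  ext i j
  have := (sq_apply_le_frobSq X i j).trans h
  simpa using le_antisymm this (sq_nonneg _)

lemma frobInner_self (X : Matrix (Fin m) (Fin n) ℝ) : frobInner X X = frobSq X := by
  simp [frobInner, frobSq, sq]

lemma frobInner_add_left (X Y D : Matrix (Fin m) (Fin n) ℝ) :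
    frobInner (X + Y) D = frobInner X D + frobInner Y D := by
  simp [frobInner, add_mul, Finset.sum_add_distrib]

lemma frobInner_neg_right (X D : Matrix (Fin m) (Fin n) ℝ) :
    frobInner X (-D) = -frobInner X D := by
  simp [frobInner]

lemma frobSq_add_smul (X D : Matrix (Fin m) (Fin n) ℝ) (t : ℝ) :
    frobSq (X + t • D) = frobSq X + 2 * t * frobInner X D + t ^ 2 * frobSq D := by
  simp only [frobSq, frobInner, Finset.mul_sum, ← Finset.sum_add_distrib, Matrix.add_apply,
    Matrix.smul_apply, smul_eq_mul]
  refine Finset.sum_congr rfl fun i _ => Finset.sum_congr rfl fun j _ => ?_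
  ring

lemma frobInner_eq_trace (X Y : Matrix (Fin m) (Fin n) ℝ) :
    frobInner X Y = (X * Yᵀ).trace := by
  simp [frobInner, Matrix.trace, Matrix.mul_apply]

lemma frobInner_mul_transpose_left (G : Matrix (Fin m) (Fin n) ℝ) (P : Matrix (Fin m) (Fin s) ℝ)
    (H : Matrix (Fin n) (Fin s) ℝ) : frobInner G (P * Hᵀ) = frobInner (G * H) P := by
  simp [frobInner_eq_trace, Matrix.mul_assoc]

lemma frobInner_mul_transpose_right (G : Matrix (Fin m) (Fin n) ℝ) (Z : Matrix (Fin m) (Fin s) ℝ)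
    (Q : Matrix (Fin n) (Fin s) ℝ) : frobInner G (Z * Qᵀ) = frobInner (Gᵀ * Z) Q := by
  rw [frobInner_eq_trace, frobInner_eq_trace, ← Matrix.trace_transpose (Gᵀ * Z * Qᵀ)]
  simp only [Matrix.transpose_mul, Matrix.transpose_transpose]
  rw [← Matrix.mul_assoc, Matrix.trace_mul_comm, ← Matrix.mul_assoc, ← Matrix.mul_assoc]
  rw [Matrix.trace_mul_comm, ← Matrix.mul_assoc]

end frob

lemma rowNorm_sq {K N : ℕ} (X : Matrix (Fin K) (Fin N) ℝ) (i : Fin K) :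
    rowNorm X i ^ 2 = ∑ j, X i j ^ 2 :=
  Real.sq_sqrt (Finset.sum_nonneg fun _ _ => sq_nonneg _)

/-! ### Expansion of the augmented Lagrangian -/

variable {K N r L : ℕ}

/-- Half the gradient, with respect to `X = Z Hᵀ`, of the part of the augmented Lagrangian that
depends on `X` only; `β = α - σ (A X - y)` is the updated multiplier. -/
noncomputable def halfGradient (A : Matrix (Fin K) (Fin N) ℝ →ₗ[ℝ] EuclideanSpace ℂ (Fin L)) (lam : ℝ)
    (w : Fin K → ℝ) (β : EuclideanSpace ℂ (Fin L)) (X : Matrix (Fin K) (Fin N) ℝ) :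
    Matrix (Fin K) (Fin N) ℝ :=
  Matrix.of fun i j =>
    -(inner ℂ β (A (Matrix.single i j 1))).re + lam ^ 2 * (X i j / w i)

lemma re_inner_map_eq_sum (A : Matrix (Fin K) (Fin N) ℝ →ₗ[ℝ] EuclideanSpace ℂ (Fin L))
    (β : EuclideanSpace ℂ (Fin L)) (D : Matrix (Fin K) (Fin N) ℝ) :
    (inner ℂ β (A D)).re = ∑ i, ∑ j, (inner ℂ β (A (Matrix.single i j 1))).re * D i j := by
  conv_lhs => rw [Matrix.matrix_eq_sum_single D]
  simp only [map_sum, inner_sum, Complex.re_sum]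
  refine Finset.sum_congr rfl fun i _ => Finset.sum_congr rfl fun j _ => ?_
  have : Matrix.single i j (D i j) = D i j • Matrix.single i j (1 : ℝ) := by simp
  rw [this, map_smul, ← Complex.coe_smul, inner_smul_right, Complex.re_ofReal_mul, mul_comm]

lemma frobInner_halfGradient (A : Matrix (Fin K) (Fin N) ℝ →ₗ[ℝ] EuclideanSpace ℂ (Fin L))
    (lam : ℝ) (w : Fin K → ℝ) (β : EuclideanSpace ℂ (Fin L)) (X D : Matrix (Fin K) (Fin N) ℝ) :
    frobInner (halfGradient A lam w β X) D =
      -(inner ℂ β (A D)).re + lam ^ 2 * ∑ i, (∑ j, X i j * D i j) / w i := by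
  rw [re_inner_map_eq_sum]
  simp only [frobInner, halfGradient, Matrix.of_apply, ← Finset.sum_neg_distrib, Finset.mul_sum,
    Finset.sum_div, ← Finset.sum_add_distrib]
  refine Finset.sum_congr rfl fun i _ => Finset.sum_congr rfl fun j _ => ?_
  ring

/-- The augmented Lagrangian is quadratic in the product `X = Z Hᵀ`. -/
lemma augLagrangian_expand (A : Matrix (Fin K) (Fin N) ℝ →ₗ[ℝ] EuclideanSpace ℂ (Fin L))
    (y : EuclideanSpace ℂ (Fin L)) (lam σ : ℝ) (Z Z' : Matrix (Fin K) (Fin r) ℝ)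
    (H H' : Matrix (Fin N) (Fin r) ℝ) (w : Fin K → ℝ) (α : EuclideanSpace ℂ (Fin L))
    (D : Matrix (Fin K) (Fin N) ℝ) (s : ℝ) (hD : Z' * H'ᵀ = Z * Hᵀ + s • D) :
    augLagrangian A y lam σ Z' H' w α - augLagrangian A y lam σ Z H w α =
      frobSq Z' - frobSq Z + (frobSq H' - frobSq H)
        + 2 * s * frobInner
            (halfGradient A lam w (α - σ • (A (Z * Hᵀ) - y)) (Z * Hᵀ)) D
        + s ^ 2 * (σ * ‖A D‖ ^ 2 + lam ^ 2 * ∑ i, (∑ j, D i j ^ 2) / w i) := by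
  rw [frobInner_halfGradient]
  unfold augLagrangian
  rw [hD]
  set X := Z * Hᵀ
  have e1 : A (X + s • D) - y = (A X - y) + (s : ℂ) • A D := by
    rw [map_add, map_smul, Complex.coe_smul]; abel
  set e := A X - y
  have e2 : ‖e + (s : ℂ) • A D‖ ^ 2 =
      ‖e‖ ^ 2 + 2 * (s * (inner ℂ e (A D)).re) + s ^ 2 * ‖A D‖ ^ 2 := by
    rw [@norm_add_sq ℂ, inner_smul_right, norm_smul, mul_pow]
    simp
  have e3 : (inner ℂ (α - σ • e) (A D)).re = (inner ℂ α (A D)).re - σ * (inner ℂ e (A D)).re := by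
    rw [← Complex.coe_smul, inner_sub_left, inner_smul_left]
    simp
  have e4 : ∑ i, (w i + lam ^ 2 * (rowNorm (X + s • D) i ^ 2 / w i)) =
      ∑ i, (w i + lam ^ 2 * (rowNorm X i ^ 2 / w i))
        + 2 * s * (lam ^ 2 * ∑ i, (∑ j, X i j * D i j) / w i)
        + s ^ 2 * (lam ^ 2 * ∑ i, (∑ j, D i j ^ 2) / w i) := by
    simp only [Finset.mul_sum, ← Finset.sum_add_distrib, rowNorm_sq]
    refine Finset.sum_congr rfl fun i _ => ?_
    have : ∑ j, (X + s • D) i j ^ 2 =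
        ∑ j, X i j ^ 2 + 2 * s * ∑ j, X i j * D i j + s ^ 2 * ∑ j, D i j ^ 2 := by
      simp only [Finset.mul_sum, ← Finset.sum_add_distrib, Matrix.add_apply, Matrix.smul_apply,
        smul_eq_mul]
      exact Finset.sum_congr rfl fun j _ => by ring
    rw [this]
    ring
  rw [e1, e2, e3, e4, inner_add_right, inner_smul_right]
  simp only [Complex.add_re, Complex.re_ofReal_mul]
  ring

/-- Divide by `t` and let `t → 0`. One-sided `t` suffices, and is all that the second-order
condition offers, where `t` is the square of a step. -/
lemma nonneg_of_eventually_quadratic {a b : ℝ}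
    (h : ∀ᶠ t in 𝓝[>] (0 : ℝ), 0 ≤ a * t + b * t ^ 2) : 0 ≤ a := by
  have hlim : Tendsto (fun t : ℝ => a + b * t) (𝓝[>] 0) (𝓝 a) := by
    have : Continuous fun t : ℝ => a + b * t := by fun_prop
    simpa using (this.tendsto 0).mono_left nhdsWithin_le_nhds
  refine ge_of_tendsto hlim ?_
  filter_upwards [h, self_mem_nhdsWithin] with t ht (hpos : 0 < t)
  refine nonneg_of_mul_nonneg_left (b := t) ?_ hpos
  linarith [ht]

lemma IsInnerLocalMin.eventually_le
    {A : Matrix (Fin K) (Fin N) ℝ →ₗ[ℝ] EuclideanSpace ℂ (Fin L)}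
    {y : EuclideanSpace ℂ (Fin L)} {lam σ : ℝ} {w : Fin K → ℝ} {α : EuclideanSpace ℂ (Fin L)}
    {Z : Matrix (Fin K) (Fin r) ℝ} {H : Matrix (Fin N) (Fin r) ℝ}
    (h : IsInnerLocalMin A y lam σ w α Z H)
    (P : Matrix (Fin K) (Fin r) ℝ) (Q : Matrix (Fin N) (Fin r) ℝ) :
    ∀ᶠ t : ℝ in 𝓝 0, augLagrangian A y lam σ Z H w α ≤
      augLagrangian A y lam σ (Z + t • P) (H + t • Q) w α := by
  have hc : Continuous fun t : ℝ => (Z + t • P, H + t • Q) := by fun_prop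
  have := hc.tendsto 0
  simp only [zero_smul, add_zero] at this
  exact this.eventually h

/-! ### First- and second-order conditions -/

section localMin

variable {A : Matrix (Fin K) (Fin N) ℝ →ₗ[ℝ] EuclideanSpace ℂ (Fin L)}
  {y : EuclideanSpace ℂ (Fin L)} {lam σ : ℝ} {w : Fin K → ℝ} {α : EuclideanSpace ℂ (Fin L)}
  {Z : Matrix (Fin K) (Fin r) ℝ} {H : Matrix (Fin N) (Fin r) ℝ} {G : Matrix (Fin K) (Fin N) ℝ}

lemma IsInnerLocalMin.stationary_left (h : IsInnerLocalMin A y lam σ w α Z H)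
    (hG : G = halfGradient A lam w (α - σ • (A (Z * Hᵀ) - y)) (Z * Hᵀ)) :
    Z + G * H = 0 := by
  set P := -(Z + G * H) with hP
  have key : 0 ≤ 2 * (frobInner Z P + frobInner G (P * Hᵀ)) := by
    refine nonneg_of_eventually_quadratic (b := frobSq P + (σ * ‖A (P * Hᵀ)‖ ^ 2
      + lam ^ 2 * ∑ i, (∑ j, (P * Hᵀ) i j ^ 2) / w i)) ?_
    filter_upwards [(h.eventually_le P 0).filter_mono nhdsWithin_le_nhds] with t ht
    have := augLagrangian_expand A y lam σ Z (Z + t • P) H (H + t • 0) w α (P * Hᵀ) t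
      (by simp [Matrix.add_mul])
    rw [← hG, frobSq_add_smul, smul_zero, add_zero] at this
    rw [smul_zero, add_zero] at ht
    linarith
  rw [frobInner_mul_transpose_left, ← frobInner_add_left, hP, frobInner_neg_right,
    frobInner_self] at key
  exact eq_zero_of_frobSq_nonpos (by linarith)

lemma IsInnerLocalMin.stationary_right (h : IsInnerLocalMin A y lam σ w α Z H)
    (hG : G = halfGradient A lam w (α - σ • (A (Z * Hᵀ) - y)) (Z * Hᵀ)) :
    H + Gᵀ * Z = 0 := by
  set Q := -(H + Gᵀ * Z) with hQ
  have key : 0 ≤ 2 * (frobInner H Q + frobInner G (Z * Qᵀ)) := by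
    refine nonneg_of_eventually_quadratic (b := frobSq Q + (σ * ‖A (Z * Qᵀ)‖ ^ 2
      + lam ^ 2 * ∑ i, (∑ j, (Z * Qᵀ) i j ^ 2) / w i)) ?_
    filter_upwards [(h.eventually_le 0 Q).filter_mono nhdsWithin_le_nhds] with t ht
    have := augLagrangian_expand A y lam σ Z (Z + t • 0) H (H + t • Q) w α (Z * Qᵀ) t
      (by simp [Matrix.mul_add])
    rw [← hG, frobSq_add_smul H, smul_zero, add_zero] at this
    rw [smul_zero, add_zero] at ht
    linarith
  rw [frobInner_mul_transpose_right, ← frobInner_add_left, hQ, frobInner_neg_right,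
    frobInner_self] at key
  exact eq_zero_of_frobSq_nonpos (by linarith)

/-- The second-order condition in directions that leave the product unchanged to first order. -/
lemma IsInnerLocalMin.second_order (h : IsInnerLocalMin A y lam σ w α Z H)
    (hG : G = halfGradient A lam w (α - σ • (A (Z * Hᵀ) - y)) (Z * Hᵀ))
    {P : Matrix (Fin K) (Fin r) ℝ} {Q : Matrix (Fin N) (Fin r) ℝ}
    (hPH : P * Hᵀ = 0) (hZQ : Z * Qᵀ = 0) (hZP : frobInner Z P = 0) (hHQ : frobInner H Q = 0) :
    0 ≤ frobSq P + frobSq Q + 2 * frobInner G (P * Qᵀ) := by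
  refine nonneg_of_eventually_quadratic (b := σ * ‖A (P * Qᵀ)‖ ^ 2
      + lam ^ 2 * ∑ i, (∑ j, (P * Qᵀ) i j ^ 2) / w i) ?_
  -- Moving both factors by `√t` moves the product by exactly `t • P * Qᵀ`, so the curvature in the
  -- factors competes with `G` at first order in `t`.
  have hs : Tendsto Real.sqrt (𝓝[>] 0) (𝓝 0) := by
    simpa using (Real.continuous_sqrt.tendsto 0).mono_left nhdsWithin_le_nhds
  filter_upwards [hs.eventually (h.eventually_le P Q), self_mem_nhdsWithin]
    with t ht (hpos : 0 < t)
  have hst : √t ^ 2 = t := Real.sq_sqrt hpos.le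
  have := augLagrangian_expand A y lam σ Z (Z + √t • P) H (H + √t • Q) w α (P * Qᵀ) t
      (by simp [Matrix.add_mul, Matrix.mul_add, hPH, hZQ, smul_smul, ← sq, hst])
  rw [← hG, frobSq_add_smul, frobSq_add_smul, hZP, hHQ, hst] at this
  linarith

end localMin

/-! ### Rank and kernel arguments -/

section rank

variable {m n s : ℕ}

lemma rank_sub_le (X Y : Matrix (Fin m) (Fin n) ℝ) : (X - Y).rank ≤ X.rank + Y.rank := by
  unfold Matrix.rank
  refine (Submodule.finrank_mono ?_).trans (Submodule.finrank_add_le_finrank_add_finrank _ _)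
  rintro _ ⟨v, rfl⟩
  rw [Matrix.mulVecLin_apply, Matrix.sub_mulVec]
  exact Submodule.sub_mem _ (Submodule.mem_sup_left ⟨v, rfl⟩) (Submodule.mem_sup_right ⟨v, rfl⟩)

/-- If `Z` and `H` are balanced and `Z Hᵀ` does not have full rank, then `Z` and `H` have a common
kernel vector. -/
lemma exists_common_kernel {Z : Matrix (Fin m) (Fin s) ℝ} {H : Matrix (Fin n) (Fin s) ℝ}
    (hbal : Zᵀ * Z = Hᵀ * H) (hr : (Z * Hᵀ).rank < s) :
    ∃ v : Fin s → ℝ, v ≠ 0 ∧ Z *ᵥ v = 0 ∧ H *ᵥ v = 0 := by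
  have hunit : ¬ IsUnit (Hᵀ * H) := by
    intro hu
    have h1 : (Zᵀ * (Z * Hᵀ) * H).rank = s := by
      have : Zᵀ * (Z * Hᵀ) * H = (Hᵀ * H) * (Hᵀ * H) := by
        rw [← Matrix.mul_assoc, hbal, Matrix.mul_assoc]
      rw [this, Matrix.rank_of_isUnit _ (hu.mul hu), Fintype.card_fin]
    have h2 := (Matrix.rank_mul_le_left (Zᵀ * (Z * Hᵀ)) H).trans
      (Matrix.rank_mul_le_right Zᵀ (Z * Hᵀ))
    omega
  have hdet : (Hᵀ * H).det = 0 := by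
    by_contra h
    exact hunit ((Matrix.isUnit_iff_isUnit_det _).2 (isUnit_iff_ne_zero.2 h))
  obtain ⟨v, hv, hv0⟩ := Matrix.exists_mulVec_eq_zero_iff.2 hdet
  have aux : ∀ {p : ℕ} (M : Matrix (Fin p) (Fin s) ℝ), (Mᵀ * M) *ᵥ v = 0 → M *ᵥ v = 0 := by
    intro p M hM
    have : (M *ᵥ v) ⬝ᵥ (M *ᵥ v) = 0 := by
      rw [Matrix.dotProduct_mulVec, ← Matrix.mulVec_transpose, Matrix.mulVec_mulVec, hM,
        zero_dotProduct]
    exact dotProduct_self_eq_zero.1 this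
  exact ⟨v, hv, aux Z (hbal ▸ hv0), aux H hv0⟩

/-- Here `Z` is square and invertible, so `G * Gᵀ = 1` and the rows of `G` are unit vectors. -/
lemma abs_apply_le_one_of_mul_transpose {G : Matrix (Fin m) (Fin n) ℝ}
    {Z : Matrix (Fin m) (Fin m) ℝ} (hZ : Z.rank = m) (h : G * Gᵀ * Z = Z)
    (i : Fin m) (j : Fin n) : |G i j| ≤ 1 := by
  have hu : IsUnit Z := by
    rw [Matrix.isUnit_iff_isUnit_det, isUnit_iff_ne_zero]
    intro hdet
    obtain ⟨v, hv, hv0⟩ := Matrix.exists_mulVec_eq_zero_iff.2 hdet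
    have h1 := LinearMap.finrank_range_add_finrank_ker Z.mulVecLin
    rw [Module.finrank_fin_fun] at h1
    have h2 : Module.finrank ℝ (LinearMap.ker Z.mulVecLin) = 0 := by
      have : Module.finrank ℝ (LinearMap.range Z.mulVecLin) = m := hZ
      omega
    have h3 : v ∈ LinearMap.ker Z.mulVecLin := hv0
    rw [Submodule.finrank_eq_zero.1 h2] at h3
    exact hv h3
  have hG : G * Gᵀ = 1 := hu.mul_right_cancel (by rw [h, one_mul])
  have h1 : ∑ k, G i k * G i k = 1 := by
    simpa [Matrix.mul_apply] using congrFun (congrFun hG i) i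
  have h2 : G i j * G i j ≤ 1 := h1 ▸
    Finset.single_le_sum (f := fun k => G i k * G i k) (fun _ _ => mul_self_nonneg _)
      (Finset.mem_univ j)
  exact (sq_le_one_iff_abs_le_one _).1 (by rwa [sq])

end rank

variable {A : Matrix (Fin K) (Fin N) ℝ →ₗ[ℝ] EuclideanSpace ℂ (Fin L)}
  {y : EuclideanSpace ℂ (Fin L)} {lam σ : ℝ} {w : Fin K → ℝ} {α : EuclideanSpace ℂ (Fin L)}
  {Z : Matrix (Fin K) (Fin r) ℝ} {H : Matrix (Fin N) (Fin r) ℝ} {G : Matrix (Fin K) (Fin N) ℝ}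

/-- A common kernel vector of `Z` and `H` at a local minimum bounds the half gradient. -/
lemma IsInnerLocalMin.abs_le_one_of_common_kernel (h : IsInnerLocalMin A y lam σ w α Z H)
    (hG : G = halfGradient A lam w (α - σ • (A (Z * Hᵀ) - y)) (Z * Hᵀ))
    {v : Fin r → ℝ} (hv : v ≠ 0) (hZv : Z *ᵥ v = 0) (hHv : H *ᵥ v = 0)
    (i : Fin K) (j : Fin N) : |G i j| ≤ 1 := by
  have hc : 0 < v ⬝ᵥ v := by
    refine lt_of_le_of_ne ?_ fun h0 => hv (dotProduct_self_eq_zero.1 h0.symm)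
    exact Finset.sum_nonneg fun _ _ => mul_self_nonneg _
  -- Second-order condition with `P = e_i vᵀ` and `Q = ε e_j vᵀ`; the signs `ε = ±1` give the two
  -- bounds.
  have key : ∀ ε : ℝ, 0 ≤ v ⬝ᵥ v * (1 + ε ^ 2 + 2 * (ε * G i j)) := by
    intro ε
    have frob : ∀ {p : ℕ} (a : Fin p) (c : ℝ),
        frobSq (vecMulVec (Pi.single a c) v) = c ^ 2 * v ⬝ᵥ v := by
      intro p a c
      rw [frobSq, Finset.sum_eq_single a]
      · simp only [vecMulVec_apply, Pi.single_eq_same, dotProduct, Finset.mul_sum]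
        exact Finset.sum_congr rfl fun _ _ => by ring
      · intro b _ hb; simp [vecMulVec_apply, hb]
      · simp
    have orth : ∀ {p : ℕ} (M : Matrix (Fin p) (Fin r) ℝ) (u : Fin p → ℝ), M *ᵥ v = 0 →
        frobInner M (vecMulVec u v) = 0 := by
      intro p M u hM
      rw [frobInner_eq_trace, transpose_vecMulVec, mul_vecMulVec, hM]
      simp [Matrix.trace]
    have h2 := h.second_order hG (P := vecMulVec (Pi.single i 1) v)
      (Q := vecMulVec (Pi.single j ε) v)
      (by rw [vecMulVec_mul, Matrix.vecMul_transpose, hHv]; ext; simp [vecMulVec_apply])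
      (by rw [transpose_vecMulVec, mul_vecMulVec, hZv]; ext; simp [vecMulVec_apply])
      (orth Z _ hZv) (orth H _ hHv)
    have h3 : frobInner G (vecMulVec (Pi.single i 1) v * (vecMulVec (Pi.single j ε) v)ᵀ)
        = v ⬝ᵥ v * (ε * G i j) := by
      rw [transpose_vecMulVec, vecMulVec_mul_vecMulVec, frobInner, Finset.sum_eq_single i,
        Finset.sum_eq_single j]
      · simp [vecMulVec_apply]; ring
      · intro b _ hb; simp [vecMulVec_apply, hb]
      · simp
      · intro b _ hb; simp [vecMulVec_apply, hb]
      · simp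
    rw [frob, frob, h3] at h2
    linarith
  have h1 := nonneg_of_mul_nonneg_right (key 1) hc
  have h2 := nonneg_of_mul_nonneg_right (key (-1)) hc
  exact abs_le.2 ⟨by linarith, by linarith⟩

/-- At a local minimum of sufficiently large inner dimension, the half gradient has entries of
modulus at most one. -/
lemma IsInnerLocalMin.abs_halfGradient_le_one (h : IsInnerLocalMin A y lam σ w α Z H)
    (hr : min K N ≤ r ∨ (Z * Hᵀ).rank < r) (i : Fin K) (j : Fin N) :
    |halfGradient A lam w (α - σ • (A (Z * Hᵀ) - y)) (Z * Hᵀ) i j| ≤ 1 := by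
  obtain ⟨G, hG⟩ : ∃ G, G = halfGradient A lam w (α - σ • (A (Z * Hᵀ) - y)) (Z * Hᵀ) := ⟨_, rfl⟩
  rw [← hG]
  have hZ : G * H = -Z := (neg_eq_of_add_eq_zero_right (h.stationary_left hG)).symm
  have hH : Gᵀ * Z = -H := (neg_eq_of_add_eq_zero_right (h.stationary_right hG)).symm
  by_cases hlt : (Z * Hᵀ).rank < r
  -- Stationarity balances the factors: both sides equal `-(Zᵀ * G * H)`.
  · have hbal : Zᵀ * Z = Hᵀ * H := by
      have h1 : Z = -(G * H) := by rw [hZ, neg_neg]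
      have h2 : Hᵀ = -(Zᵀ * G) := by
        have := congrArg Matrix.transpose hH
        rw [Matrix.transpose_mul, Matrix.transpose_transpose, Matrix.transpose_neg] at this
        rw [this, neg_neg]
      rw [h2]
      nth_rw 2 [h1]
      rw [Matrix.mul_neg, Matrix.neg_mul, Matrix.mul_assoc]
    obtain ⟨v, hv, hZv, hHv⟩ := exists_common_kernel hbal hlt
    exact h.abs_le_one_of_common_kernel hG hv hZv hHv i j
  -- The product now has rank `r`, which forces `r = K` or `r = N`, so one factor is square and
  -- invertible; composing the two stationarity equations gives `G Gᵀ Z = Z` or `Gᵀ G H = H`.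
  · have hmin : min K N ≤ r := hr.resolve_right hlt
    have hZr : r ≤ Z.rank := (not_lt.1 hlt).trans (Matrix.rank_mul_le_left _ _)
    have hHr : r ≤ H.rank := by
      refine (not_lt.1 hlt).trans ((Matrix.rank_mul_le_right Z Hᵀ).trans ?_)
      rw [Matrix.rank_transpose]
    have hZK := Z.rank_le_height
    have hHN := H.rank_le_height
    have hZw := Z.rank_le_width
    have hHw := H.rank_le_width
    rcases min_le_iff.1 hmin with hK | hN
    · obtain rfl : r = K := by omega
      refine abs_apply_le_one_of_mul_transpose (le_antisymm hZw hZr) ?_ i j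
      rw [Matrix.mul_assoc, hH, Matrix.mul_neg, hZ, neg_neg]
    · obtain rfl : r = N := by omega
      refine abs_apply_le_one_of_mul_transpose (G := Gᵀ) (le_antisymm hHw hHr) ?_ j i
      rw [Matrix.transpose_transpose, Matrix.mul_assoc, hZ, Matrix.mul_neg, hH, neg_neg]

/-- On the range of `A`, the norm is controlled by the entries of the adjoint. -/
lemma exists_norm_map_le (A : Matrix (Fin K) (Fin N) ℝ →ₗ[ℝ] EuclideanSpace ℂ (Fin L)) :
    ∃ C : ℝ, 0 ≤ C ∧ ∀ (B : Matrix (Fin K) (Fin N) ℝ) (t : ℝ), 0 ≤ t →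
      (∀ i j, |(inner ℂ (A B) (A (Matrix.single i j 1))).re| ≤ t) → ‖A B‖ ≤ C * t := by
  let f : LinearMap.range A →ₗ[ℝ] (Fin K → Fin N → ℝ) :=
    { toFun := fun x i j => (inner ℂ (x : EuclideanSpace ℂ (Fin L)) (A (Matrix.single i j 1))).re
      map_add' := fun x z => by
        ext i j
        simp
      map_smul' := fun c x => by
        ext i j
        simp only [Submodule.coe_smul, Pi.smul_apply, RingHom.id_apply, smul_eq_mul]
        rw [← Complex.coe_smul, inner_smul_left]
        simp }
  -- If `A B` is orthogonal (in real part) to every `A E_ij`, it is orthogonal to itself.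
  -- Injectivity in finite dimension then yields `C`.
  have hf : LinearMap.ker f = ⊥ := by
    rw [LinearMap.ker_eq_bot']
    rintro ⟨_, B, rfl⟩ hB
    have h0 : (inner ℂ (A B) (A B)).re = 0 := by
      rw [re_inner_map_eq_sum]
      refine Finset.sum_eq_zero fun i _ => Finset.sum_eq_zero fun j _ => ?_
      have : (inner ℂ (A B) (A (Matrix.single i j 1))).re = 0 := congrFun (congrFun hB i) j
      rw [this, zero_mul]
    have h1 : ‖A B‖ ^ 2 = 0 := by rw [← h0]; exact norm_sq_eq_re_inner (𝕜 := ℂ) _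
    exact Subtype.ext (norm_eq_zero.1 (pow_eq_zero_iff two_ne_zero |>.1 h1))
  obtain ⟨C, -, hC⟩ := f.exists_antilipschitzWith hf
  refine ⟨C, C.2, fun B t ht hB => ?_⟩
  have h1 := hC.le_mul_dist ⟨A B, B, rfl⟩ 0
  rw [map_zero, dist_zero_right, dist_zero_right] at h1
  refine le_trans h1 (mul_le_mul_of_nonneg_left ?_ C.2)
  exact (pi_norm_le_iff_of_nonneg ht).2 fun i => (pi_norm_le_iff_of_nonneg ht).2 fun j => hB i j

lemma tendsto_zero_of_recursion {b η : ℕ → ℝ} {ρ : ℝ} (hb : ∀ k, 0 ≤ b k)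
    (hη : ∀ k, 0 ≤ η k) (hη0 : Tendsto η atTop (𝓝 0))
    (h : ∀ k, b (k + 1) ≤ η k * (1 + b k + ρ * b (k + 1))) : Tendsto b atTop (𝓝 0) := by
  have h1 : ∀ᶠ k in atTop, η k * ρ < 1 / 2 := by
    refine (hη0.mul_const ρ).eventually_lt_const ?_
    norm_num
  have h2 : ∀ᶠ k in atTop, η k < 1 / 4 := hη0.eventually_lt_const (by norm_num)
  obtain ⟨n, hn⟩ := eventually_atTop.1 (h1.and h2)
  -- The implicit term `η k * ρ * b (k + 1)` is at most half of the left side and is absorbed.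
  have step : ∀ k, n ≤ k → b (k + 1) ≤ 2 * η k * (1 + b k) := by
    intro k hk
    have := mul_le_mul_of_nonneg_right (hn k hk).1.le (hb (k + 1))
    linarith [h k]
  set B := max (b n) 1
  have hB1 : 1 ≤ B := le_max_right _ _
  -- `b (k + 1) ≤ (1 + b k) / 2`, which preserves any upper bound `B ≥ 1`.
  have bound : ∀ k, n ≤ k → b k ≤ B := by
    intro k hk
    induction k, hk using Nat.le_induction with
    | base => exact le_max_left _ _
    | succ k hk ih =>
      have h3 := mul_le_mul_of_nonneg_right (hn k hk).2.le (show 0 ≤ 1 + b k by linarith [hb k])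
      linarith [step k hk]
  rw [← tendsto_add_atTop_iff_nat 1]
  refine squeeze_zero' (Eventually.of_forall fun k => hb _) (g := fun k => 2 * η k * (1 + B)) ?_ ?_
  · filter_upwards [eventually_ge_atTop n] with k hk
    refine (step k hk).trans (mul_le_mul_of_nonneg_left ?_ (by linarith [hη k]))
    linarith [bound k hk]
  · simpa using (hη0.const_mul 2).mul_const (1 + B)

/-! ### Multipliers and residuals along a run -/

section run

variable {ρ σ₀ ε₀ δ : ℝ} {Z : ℕ → Matrix (Fin K) (Fin r) ℝ}
  {H : ℕ → Matrix (Fin N) (Fin r) ℝ} {w : ℕ → Fin K → ℝ} {α : ℕ → EuclideanSpace ℂ (Fin L)}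
  {σ : ℕ → ℝ}

lemma IsRun.σ_eq (h : IsRun A y lam ρ σ₀ ε₀ Z H w α σ) (k : ℕ) : σ k = σ₀ * ρ ^ k := by
  induction k with
  | zero => simp [h.σ_zero]
  | succ k ih => rw [h.σ_succ, ih]; ring

lemma IsRun.le_w (h : IsRun A y lam ρ σ₀ ε₀ Z H w α σ) (hlam : 0 ≤ lam) (k : ℕ) (i : Fin K) :
    ε₀ / ((k : ℝ) + 1) ^ 2 ≤ w k i := by
  cases k with
  | zero =>
    have := mul_nonneg hlam (Real.sqrt_nonneg (∑ j, (Z 0 * (H 0)ᵀ) i j ^ 2))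
    simp [h.w_zero, rowNorm, this]
  | succ k =>
    have := mul_nonneg hlam (Real.sqrt_nonneg (∑ j, (Z (k + 1) * (H (k + 1))ᵀ) i j ^ 2))
    have e : ((k + 1 : ℕ) : ℝ) + 1 = (k : ℝ) + 2 := by push_cast; ring
    rw [h.w_succ, e]
    simpa [rowNorm] using this

/-- Needed because `exists_norm_map_le` bounds only vectors in the range of `A`. -/
lemma IsRun.multiplier_mem_range (h : IsRun A y lam ρ σ₀ ε₀ Z H w α σ)
    (hy : y ∈ LinearMap.range A) (k : ℕ) : α k ∈ LinearMap.range A := by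
  induction k with
  | zero => rw [h.α_zero]; exact Submodule.zero_mem _
  | succ k ih =>
    rw [h.α_succ]
    exact Submodule.sub_mem _ ih (Submodule.smul_mem _ _ (Submodule.sub_mem _ ⟨_, rfl⟩ hy))

lemma IsRun.norm_residual_le (h : IsRun A y lam ρ σ₀ ε₀ Z H w α σ) (hρ : 0 < ρ) (hσ₀ : 0 < σ₀)
    (k : ℕ) : ‖A (Z (k + 1) * (H (k + 1))ᵀ) - y‖ ≤
      ‖α k‖ / σ k + ρ * (‖α (k + 1)‖ / σ (k + 1)) := by
  have hσ : 0 < σ k := by rw [h.σ_eq]; positivity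
  set e := A (Z (k + 1) * (H (k + 1))ᵀ) - y
  have h1 : σ k • e = α k - α (k + 1) := by rw [h.α_succ]; simp [e]
  have h2 : σ k * ‖e‖ ≤ ‖α k‖ + ‖α (k + 1)‖ := by
    calc σ k * ‖e‖ = ‖σ k • e‖ := by rw [norm_smul, Real.norm_of_nonneg hσ.le]
      _ ≤ _ := by rw [h1]; exact norm_sub_le _ _
  have h3 : ρ * (‖α (k + 1)‖ / σ (k + 1)) = ‖α (k + 1)‖ / σ k := by
    rw [h.σ_succ]; field_simp
  rw [h3, ← add_div, le_div_iff₀ hσ]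
  linarith

/-- Feasible points of rank at most `r` are isolated: the residual controls every entry. -/
lemma RestrictedLowerBound.abs_sub_le (hA : RestrictedLowerBound A δ (2 * r)) (hδ : 0 < δ)
    {X Y : Matrix (Fin K) (Fin N) ℝ} (hX : X.rank ≤ r) (hY : Y.rank ≤ r)
    (i : Fin K) (j : Fin N) : |X i j - Y i j| ≤ ‖A X - A Y‖ / √δ := by
  have h1 := hA (X - Y) ((rank_sub_le X Y).trans (by omega))
  have h2 := mul_le_mul_of_nonneg_left (sq_apply_le_frobSq (X - Y) i j) hδ.le
  rw [map_sub] at h1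
  rw [le_div_iff₀ (Real.sqrt_pos.2 hδ)]
  refine abs_le_of_sq_le_sq' ?_ (norm_nonneg _) |>.2
  rw [mul_pow, sq_abs, Real.sq_sqrt hδ.le]
  rw [Matrix.sub_apply] at h2
  linarith

lemma IsRun.exists_multiplier_bound (h : IsRun A y lam ρ σ₀ ε₀ Z H w α σ) (hlam : 0 ≤ lam)
    (hε₀ : 0 < ε₀) (hδ : 0 < δ) (hA : RestrictedLowerBound A δ (2 * r))
    {Y : Matrix (Fin K) (Fin N) ℝ} (hY : A Y = y) (hYr : Y.rank ≤ r)
    (hr : min K N ≤ r ∨ ∀ k, (Z (k + 1) * (H (k + 1))ᵀ).rank < r) :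
    ∃ D : ℝ, 0 ≤ D ∧ ∀ k, ‖α (k + 1)‖ ≤
      D * ((k : ℝ) + 1) ^ 2 * (1 + ‖A (Z (k + 1) * (H (k + 1))ᵀ) - y‖) := by
  obtain ⟨C, hC0, hC⟩ := exists_norm_map_le A
  set c := lam ^ 2 / ε₀
  set M := √(frobSq Y)
  have hc : 0 ≤ c := by positivity
  have hM : 0 ≤ M := Real.sqrt_nonneg _
  have hs : 0 ≤ c / √δ := by positivity
  have hcM : 0 ≤ c * M := by positivity
  refine ⟨C * (1 + c * M + c / √δ), by positivity, fun k => ?_⟩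
  obtain ⟨B, hB⟩ := h.multiplier_mem_range ⟨Y, hY⟩ (k + 1)
  set X := Z (k + 1) * (H (k + 1))ᵀ with hX
  set E := ‖A X - y‖ with hE
  have hE0 : 0 ≤ E := norm_nonneg _
  set m := ((k : ℝ) + 1) ^ 2 with hm
  have hm1 : 1 ≤ m := one_le_pow₀ (by linarith [(k.cast_nonneg : (0 : ℝ) ≤ k)])
  have key : ‖A B‖ ≤ C * (m * ((1 + c * M + c / √δ) * (1 + E))) := by
    refine hC B _ (by positivity) fun i j => ?_
    have hg := (h.inner_step k).abs_halfGradient_le_one (hr.imp_right fun h => h k) i j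
    rw [← h.α_succ, ← hB, halfGradient, Matrix.of_apply, ← hX] at hg
    have hXr : X.rank ≤ r := (Matrix.rank_mul_le_left _ _).trans (Matrix.rank_le_width _)
    have hXY := hA.abs_sub_le hδ hXr hYr i j
    rw [hY, ← hE] at hXY
    have hYM : |Y i j| ≤ M := Real.abs_le_sqrt (sq_apply_le_frobSq Y i j)
    have hXij : |X i j| ≤ M + E / √δ := by
      have := abs_add_le (X i j - Y i j) (Y i j)
      rw [sub_add_cancel] at this
      linarith
    have hw := h.le_w hlam k i
    have hw0 : 0 < ε₀ / m := by positivity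
    -- The weight term of `G` costs the factor `m = (k+1)²`, from `w k i ≥ ε₀ / m`.
    have hquot : |lam ^ 2 * (X i j / w k i)| ≤ m * (c * (M + E / √δ)) := by
      rw [abs_mul, abs_div, abs_of_nonneg (sq_nonneg lam), abs_of_pos (hw0.trans_le hw)]
      calc lam ^ 2 * (|X i j| / w k i) ≤ lam ^ 2 * ((M + E / √δ) / (ε₀ / m)) := by gcongr
        _ = m * (c * (M + E / √δ)) := by simp only [c]; field_simp
    set u := (inner ℂ (A B) (A (Matrix.single i j 1))).re
    have hu : |u| ≤ 1 + m * (c * (M + E / √δ)) := by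
      rw [abs_le] at hg hquot ⊢
      constructor <;> linarith [hg.1, hg.2, hquot.1, hquot.2]
    have e : c * (M + E / √δ) = c * M + c / √δ * E := by ring
    have hexp : 1 + (c * M + c / √δ * E) ≤ (1 + c * M + c / √δ) * (1 + E) := by
      have := mul_nonneg hcM hE0
      linarith
    calc |u| ≤ 1 + m * (c * (M + E / √δ)) := hu
      _ ≤ m * (1 + (c * M + c / √δ * E)) := by rw [e]; linarith
      _ ≤ _ := mul_le_mul_of_nonneg_left hexp (by linarith)
  rw [← hB]
  linarith

lemma IsRun.tendsto_residual (h : IsRun A y lam ρ σ₀ ε₀ Z H w α σ) (hlam : 0 ≤ lam)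
    (hρ : 1 < ρ) (hσ₀ : 0 < σ₀) (hε₀ : 0 < ε₀) (hδ : 0 < δ)
    (hA : RestrictedLowerBound A δ (2 * r))
    {Y : Matrix (Fin K) (Fin N) ℝ} (hY : A Y = y) (hYr : Y.rank ≤ r)
    (hr : min K N ≤ r ∨ ∀ k, (Z (k + 1) * (H (k + 1))ᵀ).rank < r) :
    Tendsto (fun k => ‖A (Z (k + 1) * (H (k + 1))ᵀ) - y‖) atTop (𝓝 0) := by
  have hρ0 : 0 < ρ := by linarith
  obtain ⟨D, hD0, hD⟩ := h.exists_multiplier_bound hlam hε₀ hδ hA hY hYr hr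
  have hσ : ∀ k, 0 < σ k := fun k => by rw [h.σ_eq]; positivity
  have hb : Tendsto (fun k => ‖α k‖ / σ k) atTop (𝓝 0) := by
    refine tendsto_zero_of_recursion (η := fun k => D * ((k : ℝ) + 1) ^ 2 / σ (k + 1)) (ρ := ρ)
      (fun k => div_nonneg (norm_nonneg _) (hσ k).le)
      (fun k => div_nonneg (by positivity) (hσ _).le) ?_ fun k => ?_
    -- Here `η k = (D / σ₀) (k+1)² / ρ^(k+1)`.
    · have h1 := (tendsto_add_atTop_iff_nat 1).2
        (tendsto_pow_const_div_const_pow_of_one_lt 2 hρ)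
      have h2 := h1.const_mul (D / σ₀)
      rw [mul_zero] at h2
      refine h2.congr fun k => ?_
      rw [h.σ_eq]
      push_cast
      field_simp
    · rw [div_mul_eq_mul_div, div_le_div_iff_of_pos_right (hσ _)]
      refine (hD k).trans (mul_le_mul_of_nonneg_left ?_ (by positivity))
      linarith [h.norm_residual_le hρ0 hσ₀ k]
  have hlim := hb.add (((tendsto_add_atTop_iff_nat 1).2 hb).const_mul ρ)
  rw [mul_zero, add_zero] at hlim
  exact squeeze_zero (fun _ => norm_nonneg _) (fun k => h.norm_residual_le hρ0 hσ₀ k) hlim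

end run

end BDRCS

theorem mainTheorem2 {K N L r : ℕ}
    (A : Matrix (Fin K) (Fin N) ℝ →ₗ[ℝ] EuclideanSpace ℂ (Fin L))
    (y : EuclideanSpace ℂ (Fin L))
    (lam ρ σ₀ ε₀ δ : ℝ)
    (hlam : 0 < lam) (hρ : 1 < ρ) (hσ₀ : 0 < σ₀) (hε₀ : 0 < ε₀) (hδ : 0 < δ)
    (hA : BDRCS.RestrictedLowerBound A δ (2 * r))
    (Xstar : Matrix (Fin K) (Fin N) ℝ)
    (hXstar : BDRCS.IsMinimizer A y lam Xstar)
    (hXrank : Xstar.rank ≤ r)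
    (Z : ℕ → Matrix (Fin K) (Fin r) ℝ) (H : ℕ → Matrix (Fin N) (Fin r) ℝ)
    (w : ℕ → Fin K → ℝ) (α : ℕ → EuclideanSpace ℂ (Fin L)) (σ : ℕ → ℝ)
    (hrun : BDRCS.IsRun A y lam ρ σ₀ ε₀ Z H w α σ)
    (hr : min K N ≤ r ∨ ∀ k, (Z (k + 1) * (H (k + 1))ᵀ).rank < r) :
    Tendsto (fun k => Z k * (H k)ᵀ) atTop (𝓝 Xstar) := by
  have hres := (hrun.tendsto_residual hlam.le hρ hσ₀ hε₀ hδ hA hXstar.1 hXrank hr).div_const (√δ)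
  rw [zero_div] at hres
  rw [← tendsto_add_atTop_iff_nat 1]
  refine tendsto_pi_nhds.2 fun i => tendsto_pi_nhds.2 fun j => ?_
  refine tendsto_iff_norm_sub_tendsto_zero.2
    (squeeze_zero (fun _ => norm_nonneg _) (fun k => ?_) hres)
  have h := hA.abs_sub_le hδ (X := Z (k + 1) * (H (k + 1))ᵀ)
    ((Matrix.rank_mul_le_left _ _).trans (Matrix.rank_le_width _)) hXrank i j
  rw [hXstar.1] at h
  exact h
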